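/- Let $\mathcal H$ be a finite-dimensional complex Hilbert space (e.g. that of $N$ qubits), let $M\in\mathbb N$, $T>0$, $\omega=2\pi/T$, and let $H(t)=\sum_{m=-M}^{M}H_m e^{-im\omega t}$ be a $T$-periodic Hamiltonian on $\mathcal H$ with $H_m^\dagger=H_{-m}$ and $\|H_m\|\le\alpha$ (operator norm) for $|m|\le M$. Let $U(t;t_0)=\mathcal T\exp\bigl(-i\int_{t_0}^tH(s)\,ds\bigr)$ be its time-evolution operator, given by the Dyson series. For $L\in\mathbb N$ put $[L]=\{-L+1,\dots,L\}$ and define on $\mathcal H^L=\mathrm{span}\{|l\rangle : l\in[L]\}\otimes\mathcal H$ the truncated Floquet Hamiltonian $$H_F^L=\sum_{|m|\le M}\ \sum_{l\in[L],\,l+m\in[L]}|l+m\rangle\langle l|\otimes H_m-\sum_{l\in[L]}l\omega\,|l\rangle\langle l|\otimes I .$$ For an eigenvector $\tilde\Phi\in\mathcal H^L$ ($\tilde\Phi\neq0$) of $H_F^L$ with eigenvalue $\tilde\epsilon\in\mathbb R$ and $t\in\mathbb R$, set $$\tilde\phi(t)=e^{i\tilde\epsilon t}\,U(t;0)\sum_{l\in[L]}(\langle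 l|\otimes I)\tilde\Phi .$$ Proposition. For every $M$ there is a constant $C>0$ depending only on $M$ such that, for all $\mathcal H$, $T$, $\alpha$, $(H_m)$ as above, all $\varepsilon\in(0,1)$, all $L\in\mathbb N$ and every eigenpair $(\tilde\epsilon,\tilde\Phi)$ of $H_F^L$ as above: if $$L\ \ge\ C\left(\alpha T+\frac{|\tilde\epsilon|}{\omega}+\log\frac1\varepsilon\right),$$ then for all $t\in\mathbb R$ one has $\tilde\phi(t)\ne0$ and $$\frac{\bigl\|\bigl(U(t+T;t)-e^{-i\tilde\epsilon T}\bigr)\tilde\phi(t)\bigr\|}{\|\tilde\phi(t)\|}\ \le\ \varepsilon .$$ In particular, a cutoff $L\in\Theta\bigl(\alpha T+|\tilde\epsilon|/\omega+\log(1/\varepsilon)\bigr)$ with a sufficiently large constant suffices. -/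

import Mathlib

noncomputable section

namespace Floquet

/-- The set `[L] = {-L+1, …, L}` of Fourier indices kept by the cutoff `L`. -/
def indexSet (L : ℕ) : Finset ℤ := Finset.Icc (-(L : ℤ) + 1) (L : ℤ)

/-- The truncated Sambe space `span{|l⟩ : l ∈ [L]} ⊗ E`, with its Hilbert norm. An element is the
family of its components `(⟨l| ⊗ I) Φ`, for `l ∈ [L]`. -/
abbrev TruncatedSambe (E : Type*) (L : ℕ) : Type _ := PiLp 2 (fun _ : indexSet L => E)

/-- The angular frequency `ω = 2π / T` of the period `T`. -/
def freq (T : ℝ) : ℝ := 2 * Real.pi / T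

variable {E : Type*} [NormedAddCommGroup E] [InnerProductSpace ℂ E]

/-- The operator `|k⟩⟨l| ⊗ A` on the truncated Sambe space. -/
def ketbra {L : ℕ} (k l : indexSet L) (A : E →L[ℂ] E) :
    TruncatedSambe E L →ₗ[ℂ] TruncatedSambe E L where
  toFun Φ := PiLp.single 2 k (A (Φ l))
  map_add' Φ Ψ := by simp [PiLp.single_add]
  map_smul' c Φ := by
    ext j
    by_cases h : j = k
    · subst h; simp
    · simp [h]

/-- The truncated Floquet Hamiltonian
`∑_{|m| ≤ M} ∑_{l ∈ [L], l+m ∈ [L]} |l+m⟩⟨l| ⊗ H_m - ∑_{l ∈ [L]} l ω |l⟩⟨l| ⊗ I`. -/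
def truncatedHamiltonian (M : ℕ) (T : ℝ) (Hm : ℤ → E →L[ℂ] E) (L : ℕ) :
    Module.End ℂ (TruncatedSambe E L) :=
  (∑ m ∈ Finset.Icc (-(M : ℤ)) (M : ℤ), ∑ l : indexSet L,
      if h : (l : ℤ) + m ∈ indexSet L then ketbra ⟨(l : ℤ) + m, h⟩ l (Hm m) else 0)
    - ∑ l : indexSet L,
        (((l : ℤ) : ℂ) * (freq T : ℂ)) • ketbra l l (ContinuousLinearMap.id ℂ E)

/-- The time-periodic Hamiltonian `H(t) = ∑_{|m| ≤ M} exp(-i m ω t) H_m`. -/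
def hamiltonian (M : ℕ) (T : ℝ) (Hm : ℤ → E →L[ℂ] E) (t : ℝ) : E →L[ℂ] E :=
  ∑ m ∈ Finset.Icc (-(M : ℤ)) (M : ℤ),
    Complex.exp (-(Complex.I * ((m : ℂ) * (freq T : ℂ) * (t : ℂ)))) • Hm m

/-- The `n`-th term of the Dyson series of a time-dependent Hamiltonian `H` from time `t₀` to
time `t`, that is
`(-i)^n ∫_{t₀}^t dt₁ ∫_{t₀}^{t₁} dt₂ ⋯ ∫_{t₀}^{t_{n-1}} dt_n H(t₁) H(t₂) ⋯ H(t_n)`. -/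
def dysonTerm (H : ℝ → E →L[ℂ] E) (t₀ : ℝ) : ℕ → ℝ → E →L[ℂ] E
  | 0, _ => ContinuousLinearMap.id ℂ E
  | n + 1, t => (-Complex.I) • ∫ s in t₀..t, (H s).comp (dysonTerm H t₀ n s)

/-- The time-evolution operator `U(t; t₀)`, the time-ordered exponential
`𝒯 exp(-i ∫_{t₀}^t H(s) ds)`, as the sum of the Dyson series. -/
def evolution (H : ℝ → E →L[ℂ] E) (t t₀ : ℝ) : E →L[ℂ] E :=
  ∑' n : ℕ, dysonTerm H t₀ n t

/-- The state `exp(i e t) U(t; 0) ∑_{l ∈ [L]} (⟨l| ⊗ I) Φ`. -/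
def approxFloquetState (H : ℝ → E →L[ℂ] E) {L : ℕ} (e : ℝ) (Φ : TruncatedSambe E L) (t : ℝ) : E :=
  Complex.exp (Complex.I * ((e : ℂ) * (t : ℂ))) • evolution H t 0 (∑ l : indexSet L, Φ l)

end Floquet

end

/-! Write `φ_l` for the components of the eigenvector and `v` for their sum. The curve `ψ(t) =
e^{-iet} ∑ e^{-ilωt} φ_l` would solve the Schrödinger equation exactly without truncation. With it,
`ψ` picks up a forcing made only of the hops that leave `[L]`, hence only of components near the two
ends (`hasDerivAt_exp_smul_fourierSum`).

Those components are tiny. For `|k|` well above `|e|/ω + αT` the diagonal entry `e + kω` dominates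
the hopping, so `‖φ_k‖` is at most a third of the average over its neighbours and decays
exponentially in `|k|/(M+1)` (`mul_norm_le_sum_norm`, `le_exp_of_decay`).

Let `A` be the largest `‖φ_l‖`. Since the evolution is unitary, errors only add up, and over one
period `ψ` stays within `Aε/2` of `U(t;0)v` (`norm_le_of_forced_schrodinger`, `cutoff_estimate`). As
`ψ(T) = e^{-ieT} v`, this bounds the defect at time 0. It remains to compare `A` with `‖v‖`, where
cancellation might be feared: each `φ_k` is a Fourier coefficient of `e^{iet}ψ`, and `‖ψ‖` is nearly
the constant `‖v‖`, so `A ≤ 2‖v‖` (`norm_le_of_norm_fourierSum_le`). Periodicity of `H` carries the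
bound to every `t` (`norm_evolution_add_period_sub_eq`). -/

open MeasureTheory intervalIntegral

namespace Floquet

/-! ### Convergence and differentiation of the Dyson series. -/

section Dyson

variable {E : Type*} [NormedAddCommGroup E] [InnerProductSpace ℂ E]
  {H : ℝ → E →L[ℂ] E}

theorem continuous_dysonTerm [CompleteSpace E] (hH : Continuous H) (t₀ : ℝ) (n : ℕ) :
    Continuous (dysonTerm H t₀ n) := by
  induction n with
  | zero => exact continuous_const
  | succ n ih =>
    have hc : Continuous fun s => (H s).comp (dysonTerm H t₀ n s) := hH.clm_comp ih
    exact (continuous_primitive (μ := volume) (fun a b => hc.intervalIntegrable a b) t₀).const_smul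
      (-Complex.I)

theorem hasDerivAt_dysonTerm_succ [CompleteSpace E] (hH : Continuous H) (t₀ : ℝ) (n : ℕ) (t : ℝ) :
    HasDerivAt (dysonTerm H t₀ (n + 1)) ((-Complex.I) • (H t).comp (dysonTerm H t₀ n t)) t := by
  have hc : Continuous fun s => (H s).comp (dysonTerm H t₀ n s) :=
    hH.clm_comp (continuous_dysonTerm hH t₀ n)
  exact (hc.integral_hasStrictDerivAt t₀ t).hasDerivAt.const_smul (-Complex.I)

theorem norm_dysonTerm_le {B : ℝ} (hB : ∀ t, ‖H t‖ ≤ B) (t₀ : ℝ) (n : ℕ) (t : ℝ) :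
    ‖dysonTerm H t₀ n t‖ ≤ (B * |t - t₀|) ^ n / n.factorial := by
  have hB0 : 0 ≤ B := (norm_nonneg _).trans (hB 0)
  induction n generalizing t with
  | zero => simpa [dysonTerm] using ContinuousLinearMap.norm_id_le (𝕜 := ℂ) (E := E)
  | succ n ih =>
    have hbd : ∀ s, ‖(H s).comp (dysonTerm H t₀ n s)‖ ≤
        B ^ (n + 1) / n.factorial * |s - t₀| ^ n := fun s => by
      calc _ ≤ ‖H s‖ * ‖dysonTerm H t₀ n s‖ := ContinuousLinearMap.opNorm_comp_le _ _
        _ ≤ B * ((B * |s - t₀|) ^ n / n.factorial) := by gcongr; exacts [hB s, ih s]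
        _ = _ := by rw [mul_pow]; ring
    have hint : IntegrableOn (fun s => B ^ (n + 1) / n.factorial * |s - t₀| ^ n)
        (Set.uIoc t₀ t) := by
      rw [← intervalIntegrable_iff]
      exact Continuous.intervalIntegrable (by fun_prop) _ _
    calc ‖dysonTerm H t₀ (n + 1) t‖
        = ‖∫ s in t₀..t, (H s).comp (dysonTerm H t₀ n s)‖ := by simp [dysonTerm, norm_smul]
      _ = ‖∫ s in Set.uIoc t₀ t, (H s).comp (dysonTerm H t₀ n s)‖ :=
        norm_integral_eq_norm_integral_uIoc _
      _ ≤ ∫ s in Set.uIoc t₀ t, B ^ (n + 1) / n.factorial * |s - t₀| ^ n :=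
        norm_integral_le_of_norm_le hint (Filter.Eventually.of_forall hbd)
      _ = B ^ (n + 1) / n.factorial * (|t - t₀| ^ (n + 1) / (n + 1)) := by
        rw [MeasureTheory.integral_const_mul, integral_pow_abs_sub_uIoc]
      _ = _ := by
        rw [Nat.factorial_succ, mul_pow]; push_cast; field_simp

theorem summable_dysonTerm [CompleteSpace E] {B : ℝ} (hB : ∀ t, ‖H t‖ ≤ B) (t₀ t : ℝ) :
    Summable fun n => dysonTerm H t₀ n t :=
  Summable.of_norm_bounded (Real.summable_pow_div_factorial _) fun n => norm_dysonTerm_le hB t₀ n t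

theorem evolution_self (H : ℝ → E →L[ℂ] E) (t : ℝ) :
    evolution H t t = ContinuousLinearMap.id ℂ E := by
  rw [evolution, tsum_eq_single 0]
  · rfl
  · rintro (_ | n) hn
    · exact absurd rfl hn
    · simp [dysonTerm]

theorem hasDerivAt_tsum_of_ball {F : Type*} [NormedAddCommGroup F] [NormedSpace ℝ F]
    [CompleteSpace F] {g g' : ℕ → ℝ → F} {u : ℕ → ℝ} {R t₀ t : ℝ} (hu : Summable u)
    (hg : ∀ n y, HasDerivAt (g n) (g' n y) y) (hbd : ∀ n, ∀ y ∈ Metric.ball t₀ R, ‖g' n y‖ ≤ u n)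
    (ht : t ∈ Metric.ball t₀ R) (hsum : Summable fun n => g n t₀) :
    HasDerivAt (fun s => ∑' n, g n s) (∑' n, g' n t) t :=
  hasDerivAt_tsum_of_isPreconnected hu Metric.isOpen_ball (convex_ball t₀ _).isPreconnected
    (fun n y _ => hg n y) hbd (Metric.mem_ball_self (Metric.pos_of_mem_ball ht)) hsum ht

theorem hasDerivAt_tsum_dysonTerm_succ [CompleteSpace E] {B : ℝ} (hH : Continuous H)
    (hB : ∀ t, ‖H t‖ ≤ B) (t₀ t : ℝ) :
    HasDerivAt (fun s => ∑' n, dysonTerm H t₀ (n + 1) s)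
      (∑' n, (-Complex.I) • (H t).comp (dysonTerm H t₀ n t)) t := by
  have hB0 : 0 ≤ B := (norm_nonneg _).trans (hB 0)
  -- Termwise differentiation needs a uniform bound on an open ball; the `+ 1` in the radius puts
  -- `t` inside it.
  have hsum : Summable fun n : ℕ => B * ((B * (|t - t₀| + 1)) ^ n / n.factorial) :=
    (Real.summable_pow_div_factorial _).mul_left B
  have hbd : ∀ n y, y ∈ Metric.ball t₀ (|t - t₀| + 1) →
      ‖(-Complex.I) • (H y).comp (dysonTerm H t₀ n y)‖ ≤
        B * ((B * (|t - t₀| + 1)) ^ n / n.factorial) := fun n y hy => by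
    rw [Metric.mem_ball, Real.dist_eq] at hy
    have hy' := hy.le
    calc ‖(-Complex.I) • (H y).comp (dysonTerm H t₀ n y)‖
        = ‖(H y).comp (dysonTerm H t₀ n y)‖ := by rw [norm_smul]; simp
      _ ≤ ‖H y‖ * ‖dysonTerm H t₀ n y‖ := ContinuousLinearMap.opNorm_comp_le _ _
      _ ≤ B * ((B * |y - t₀|) ^ n / n.factorial) :=
        mul_le_mul (hB y) (norm_dysonTerm_le hB t₀ n y) (norm_nonneg _) hB0
      _ ≤ _ := by gcongr
  have ht : t ∈ Metric.ball t₀ (|t - t₀| + 1) := by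
    rw [Metric.mem_ball, Real.dist_eq]; linarith
  exact hasDerivAt_tsum_of_ball (g := fun n => dysonTerm H t₀ (n + 1))
    (g' := fun n s => (-Complex.I) • (H s).comp (dysonTerm H t₀ n s)) hsum
    (fun n y => hasDerivAt_dysonTerm_succ hH t₀ n y) hbd ht
    ((summable_nat_add_iff (f := fun n => dysonTerm H t₀ n t₀) 1).2
      (summable_dysonTerm hB t₀ t₀))

/-- Together with `evolution_self`, this is all that the later argument needs to know about the
Dyson series. -/
theorem hasDerivAt_evolution [CompleteSpace E] {B : ℝ} (hH : Continuous H) (hB : ∀ t, ‖H t‖ ≤ B)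
    (t₀ t : ℝ) :
    HasDerivAt (fun s => evolution H s t₀) ((-Complex.I) • (H t).comp (evolution H t t₀)) t := by
  have hfun : (fun s => evolution H s t₀) =
      fun s => ContinuousLinearMap.id ℂ E + ∑' n, dysonTerm H t₀ (n + 1) s := by
    ext1 s
    exact (summable_dysonTerm hB t₀ s).tsum_eq_zero_add
  have hval : (-Complex.I) • (H t).comp (evolution H t t₀) =
      ∑' n, (-Complex.I) • (H t).comp (dysonTerm H t₀ n t) :=
    ((-Complex.I) • ContinuousLinearMap.compL ℂ E E E (H t)).map_tsum (summable_dysonTerm hB t₀ t)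
  rw [hfun, hval]
  exact (hasDerivAt_tsum_dysonTerm_succ hH hB t₀ t).const_add (ContinuousLinearMap.id ℂ E)

theorem hasDerivAt_evolution_apply [CompleteSpace E] {B : ℝ} (hH : Continuous H)
    (hB : ∀ t, ‖H t‖ ≤ B) (t₀ : ℝ) (x : E) (t : ℝ) :
    HasDerivAt (fun s => evolution H s t₀ x) ((-Complex.I) • H t (evolution H t t₀ x)) t := by
  exact ((ContinuousLinearMap.apply ℂ E x).restrictScalars ℝ).hasFDerivAt.comp_hasDerivAt t
    (hasDerivAt_evolution hH hB t₀ t)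

end Dyson

/-! ### Unitarity, uniqueness and the Duhamel bound. -/

section Schrodinger

variable {E : Type*} [NormedAddCommGroup E] [InnerProductSpace ℂ E] {H : ℝ → E →L[ℂ] E}

local notation "⟪" x ", " y "⟫" => inner ℂ x y

/-- Symmetry of `H` cancels both Hamiltonian contributions, leaving only the forcing. This is
Duhamel's formula in weak form. -/
theorem hasDerivAt_inner_of_schrodinger (hsym : ∀ t x y, ⟪H t x, y⟫ = ⟪x, H t y⟫)
    {y w : ℝ → E} {g : E} {t : ℝ}
    (hy : HasDerivAt y ((-Complex.I) • H t (y t)) t)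
    (hw : HasDerivAt w ((-Complex.I) • H t (w t) + g) t) :
    HasDerivAt (fun s => ⟪y s, w s⟫) ⟪y t, g⟫ t := by
  have h := hy.inner ℂ hw
  have e : ⟪y t, (-Complex.I) • H t (w t) + g⟫ + ⟪(-Complex.I) • H t (y t), w t⟫ = ⟪y t, g⟫ := by
    rw [inner_add_right, inner_smul_right, inner_smul_left, hsym]
    simp
  rwa [e] at h

theorem norm_eq_of_schrodinger (hsym : ∀ t x y, ⟪H t x, y⟫ = ⟪x, H t y⟫) {y : ℝ → E}
    (hy : ∀ t, HasDerivAt y ((-Complex.I) • H t (y t)) t) (s t : ℝ) : ‖y s‖ = ‖y t‖ := by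
  have h : ∀ t, HasDerivAt (fun s => ⟪y s, y s⟫) 0 t := fun t => by
    have h := hasDerivAt_inner_of_schrodinger hsym (hy t) (g := 0)
      (by rw [add_zero]; exact hy t)
    rwa [inner_zero_right] at h
  have hc := is_const_of_deriv_eq_zero (fun t => (h t).differentiableAt) (fun t => (h t).deriv) s t
  simp only [inner_self_eq_norm_sq_to_K] at hc
  have hc' : ‖y s‖ ^ 2 = ‖y t‖ ^ 2 := by exact_mod_cast hc
  exact (sq_eq_sq₀ (norm_nonneg _) (norm_nonneg _)).1 hc'

theorem eq_of_schrodinger (hsym : ∀ t x y, ⟪H t x, y⟫ = ⟪x, H t y⟫) {y z : ℝ → E}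
    (hy : ∀ t, HasDerivAt y ((-Complex.I) • H t (y t)) t)
    (hz : ∀ t, HasDerivAt z ((-Complex.I) • H t (z t)) t) {t₀ : ℝ} (h₀ : y t₀ = z t₀) (t : ℝ) :
    y t = z t := by
  have h := norm_eq_of_schrodinger (y := fun s => y s - z s) hsym (fun t => by
    simpa [smul_sub, map_sub] using (hy t).fun_sub (hz t)) t t₀
  simpa [h₀, sub_eq_zero] using h

theorem norm_le_of_forced_schrodinger [CompleteSpace E] {B δ : ℝ} (hH : Continuous H)
    (hB : ∀ t, ‖H t‖ ≤ B) (hsym : ∀ t x y, ⟪H t x, y⟫ = ⟪x, H t y⟫) {w g : ℝ → E} (hw₀ : w 0 = 0)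
    (hw : ∀ t, HasDerivAt w ((-Complex.I) • H t (w t) + g t) t) (hg : ∀ t, ‖g t‖ ≤ δ) (t : ℝ) :
    ‖w t‖ ≤ δ * |t| := by
  -- The test curve is the homogeneous solution that passes through `w t` at time `t`. Its pairing
  -- with `w` vanishes at time 0 and equals `‖w t‖²` at time `t`, so the mean value inequality gives
  -- `‖w t‖² ≤ ‖w t‖ δ |t|`.
  have hy := hasDerivAt_evolution_apply hH hB t (w t)
  have hyn : ∀ s, ‖evolution H s t (w t)‖ = ‖w t‖ := fun s => by
    rw [norm_eq_of_schrodinger hsym hy s t, evolution_self]; rfl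
  have hδ : 0 ≤ δ := (norm_nonneg _).trans (hg 0)
  have key := convex_univ.norm_image_sub_le_of_norm_hasDerivWithin_le
    (f := fun s => ⟪evolution H s t (w t), w s⟫) (C := ‖w t‖ * δ) (x := 0) (y := t)
    (fun s _ => (hasDerivAt_inner_of_schrodinger hsym (hy s) (hw s)).hasDerivWithinAt)
    (fun s _ => (norm_inner_le_norm _ _).trans (by rw [hyn]; gcongr; exact hg s))
    (Set.mem_univ _) (Set.mem_univ _)
  rw [hw₀, inner_zero_right, sub_zero, sub_zero, evolution_self, ContinuousLinearMap.id_apply,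
    inner_self_eq_norm_sq_to_K, norm_pow, RCLike.norm_ofReal, abs_norm, Real.norm_eq_abs] at key
  rcases (norm_nonneg (w t)).eq_or_lt with h | h
  · rw [← h]; positivity
  · nlinarith

end Schrodinger

/-! ### Exponential decay from a discrete averaging inequality. -/

section Decay

theorem card_Icc_neg_natCast (M : ℕ) :
    ((Finset.Icc (-(M : ℤ)) (M : ℤ)).card : ℝ) = 2 * M + 1 := by
  have : (Finset.Icc (-(M : ℤ)) (M : ℤ)).card = 2 * M + 1 := by
    rw [Int.card_Icc]; omega
  rw [this]; push_cast; ring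

/-- Each move outward by `M + 1` keeps all neighbours `k - m` in the previous region, so the bound
improves by `1/3`, which beats `1/e`. A stride of `M + 1` instead of `M` stays positive when `M =
0`. -/
theorem le_mul_exp_neg_of_decay {M : ℕ} {a : ℤ → ℝ} {A k₀ : ℝ} (hA₀ : 0 ≤ A) (hA : ∀ k, a k ≤ A)
    (ha : ∀ k : ℤ, k₀ < |(k : ℝ)| → 3 * (2 * M + 1) * a k ≤
      ∑ m ∈ Finset.Icc (-(M : ℤ)) (M : ℤ), a (k - m)) (n : ℕ) :
    ∀ k : ℤ, k₀ + n * (M + 1) < |(k : ℝ)| → a k ≤ A * Real.exp (-n) := by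
  induction n with
  | zero => simpa using fun k _ => hA k
  | succ n ih =>
    intro k hk
    push_cast at hk
    have hM : (0 : ℝ) ≤ M := M.cast_nonneg
    have hn : (0 : ℝ) ≤ n * (M + 1) := by positivity
    have hsum : ∑ m ∈ Finset.Icc (-(M : ℤ)) (M : ℤ), a (k - m) ≤
        (2 * M + 1) * (A * Real.exp (-n)) := by
      have h := Finset.sum_le_card_nsmul (Finset.Icc (-(M : ℤ)) (M : ℤ)) (fun m => a (k - m))
        (A * Real.exp (-n)) (fun m hm => ih _ (by
          have hm' : |(m : ℝ)| ≤ M := by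
            rw [abs_le]; rw [Finset.mem_Icc] at hm; exact_mod_cast hm
          have := abs_sub_abs_le_abs_sub (k : ℝ) m
          push_cast
          linarith))
      rwa [nsmul_eq_mul, card_Icc_neg_natCast] at h
    have h1 := (ha k (by linarith)).trans hsum
    have h2 : 3 * a k ≤ A * Real.exp (-n) := by
      have : (0 : ℝ) < 2 * M + 1 := by positivity
      refine le_of_mul_le_mul_left ?_ this
      linarith
    have h3 : A * Real.exp (-n) = A * Real.exp (-(n + 1 : ℕ)) * Real.exp 1 := by
      rw [mul_assoc, ← Real.exp_add]; push_cast; congr 2; ring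
    have h4 : 0 ≤ A * Real.exp (-(n + 1 : ℕ)) := by positivity
    nlinarith [Real.exp_one_lt_d9]

theorem le_exp_of_decay {M : ℕ} {a : ℤ → ℝ} {A k₀ : ℝ} (hA₀ : 0 ≤ A) (hA : ∀ k, a k ≤ A)
    (ha : ∀ k : ℤ, k₀ < |(k : ℝ)| → 3 * (2 * M + 1) * a k ≤
      ∑ m ∈ Finset.Icc (-(M : ℤ)) (M : ℤ), a (k - m)) (k : ℤ) :
    a k ≤ A * Real.exp (1 - (|(k : ℝ)| - k₀) / (M + 1)) := by
  have hM : (0 : ℝ) < M + 1 := by positivity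
  rcases le_or_gt |(k : ℝ)| k₀ with hk | hk
  · refine (hA k).trans (le_mul_of_one_le_right hA₀ (Real.one_le_exp ?_))
    have : (|(k : ℝ)| - k₀) / (M + 1) ≤ 0 := div_nonpos_of_nonpos_of_nonneg (by linarith) hM.le
    linarith
  -- The number of full strides is `⌈x⌉ - 1`, since the region is defined by a strict inequality.
  -- The stride lost is the `1` in the exponent.
  · set x := (|(k : ℝ)| - k₀) / (M + 1)
    have hx : 0 < x := div_pos (by linarith) hM
    have hceil := Nat.ceil_pos.2 hx
    have hlt : ((⌈x⌉₊ - 1 : ℕ) : ℝ) < x := Nat.lt_ceil.1 (by omega)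
    have hle : x ≤ ((⌈x⌉₊ - 1 : ℕ) : ℝ) + 1 := by
      have h : ((⌈x⌉₊ - 1 : ℕ) : ℝ) + 1 = ⌈x⌉₊ := by exact_mod_cast Nat.sub_add_cancel hceil
      rw [h]; exact Nat.le_ceil x
    refine (le_mul_exp_neg_of_decay hA₀ hA ha (⌈x⌉₊ - 1) k ?_).trans ?_
    · have := (lt_div_iff₀ hM).1 hlt
      linarith
    · gcongr; linarith

end Decay

/-! ### The eigenvalue equation in components. -/

section Components

/-- The components `(⟨l| ⊗ I) Φ`, extended by zero to all `l : ℤ`. -/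
noncomputable def component {E : Type*} [NormedAddCommGroup E] {L : ℕ} (Φ : TruncatedSambe E L)
    (l : ℤ) : E :=
  if h : l ∈ indexSet L then Φ ⟨l, h⟩ else 0

theorem component_coe {E : Type*} [NormedAddCommGroup E] {L : ℕ} (Φ : TruncatedSambe E L)
    (l : indexSet L) :
    component Φ l = Φ l := by
  simp [component]

theorem component_of_notMem {E : Type*} [NormedAddCommGroup E]
    {L : ℕ} (Φ : TruncatedSambe E L) {l : ℤ} (hl : l ∉ indexSet L) :
    component Φ l = 0 := by
  simp [component, hl]

theorem sum_component {E : Type*} [NormedAddCommGroup E] {L : ℕ} (Φ : TruncatedSambe E L) :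
    ∑ l ∈ indexSet L, component Φ l = ∑ l : indexSet L, Φ l := by
  rw [← Finset.sum_coe_sort]
  exact Finset.sum_congr rfl fun l _ => component_coe Φ l

variable {E : Type*} [NormedAddCommGroup E] [InnerProductSpace ℂ E]

theorem ketbra_apply {L : ℕ} (k l : indexSet L) (A : E →L[ℂ] E) (Φ : TruncatedSambe E L)
    (j : indexSet L) : ketbra k l A Φ j = if j = k then A (Φ l) else 0 := by
  by_cases h : j = k
  · subst h; simp [ketbra]
  · simp [ketbra, h]

theorem sum_shift_apply {L : ℕ} (m : ℤ) (A : E →L[ℂ] E) (Φ : TruncatedSambe E L)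
    (k : indexSet L) :
    ((∑ l : indexSet L, if h : (l : ℤ) + m ∈ indexSet L then ketbra ⟨(l : ℤ) + m, h⟩ l A
      else 0) Φ) k = A (component Φ (k - m)) := by
  have hterm : ∀ l : indexSet L, ((if h : (l : ℤ) + m ∈ indexSet L then
      ketbra ⟨(l : ℤ) + m, h⟩ l A else 0) Φ) k = if (l : ℤ) = k - m then A (Φ l) else 0 := by
    intro l
    by_cases h : (l : ℤ) + m ∈ indexSet L
    · rw [dif_pos h, ketbra_apply]
      refine if_congr ?_ rfl rfl
      rw [Subtype.ext_iff]
      constructor <;> intro h' <;> simp only at h' ⊢ <;> omega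
    · have hne : (l : ℤ) ≠ k - m := by
        rintro h'
        exact h (by rw [h', sub_add_cancel]; exact k.2)
      rw [dif_neg h, if_neg hne]; rfl
  rw [LinearMap.sum_apply, WithLp.ofLp_sum, Finset.sum_apply,
    Finset.sum_congr rfl fun l _ => hterm l]
  by_cases hk : (k : ℤ) - m ∈ indexSet L
  · rw [Finset.sum_eq_single ⟨(k : ℤ) - m, hk⟩]
    · simp [component, hk]
    · intro l _ hl
      exact if_neg fun h => hl (Subtype.ext h)
    · simp
  · rw [component_of_notMem Φ hk, map_zero]
    refine Finset.sum_eq_zero fun l _ => if_neg fun h => hk (by rw [← h]; exact l.2)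

theorem truncatedHamiltonian_apply (M : ℕ) (T : ℝ) (Hm : ℤ → E →L[ℂ] E) {L : ℕ}
    (Φ : TruncatedSambe E L) (k : indexSet L) :
    truncatedHamiltonian M T Hm L Φ k =
      ∑ m ∈ Finset.Icc (-(M : ℤ)) (M : ℤ), Hm m (component Φ (k - m))
        - (((k : ℤ) : ℂ) * (freq T : ℂ)) • Φ k := by
  rw [truncatedHamiltonian, LinearMap.sub_apply, PiLp.sub_apply]
  congr 1
  · rw [LinearMap.sum_apply, WithLp.ofLp_sum, Finset.sum_apply]
    exact Finset.sum_congr rfl fun m _ => sum_shift_apply m (Hm m) Φ k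
  · rw [LinearMap.sum_apply, WithLp.ofLp_sum, Finset.sum_apply, Finset.sum_eq_single k]
    · simp [ketbra_apply]
    · intro l _ hl
      simp [ketbra_apply, hl.symm]
    · simp

/-- The zero extension turns the truncated eigenvalue equation into a convolution equation. It holds
only for `k ∈ [L]`; its failure outside is the source of `boundaryTerm`. -/
theorem component_eigenvector {M : ℕ} {T : ℝ} {Hm : ℤ → E →L[ℂ] E} {L : ℕ} {e : ℝ}
    {Φ : TruncatedSambe E L}
    (hΦ : Module.End.HasEigenvector (truncatedHamiltonian M T Hm L) (e : ℂ) Φ)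
    {k : ℤ} (hk : k ∈ indexSet L) :
    ∑ m ∈ Finset.Icc (-(M : ℤ)) (M : ℤ), Hm m (component Φ (k - m)) =
      ((e : ℂ) + (k : ℂ) * (freq T : ℂ)) • component Φ k := by
  have h := congrArg (fun Ψ : TruncatedSambe E L => Ψ ⟨k, hk⟩) hΦ.apply_eq_smul
  simp only [truncatedHamiltonian_apply, PiLp.smul_apply] at h
  rw [sub_eq_iff_eq_add] at h
  rw [h, add_smul, component, dif_pos hk]

end Components

/-! ### Diagonal dominance far from the resonant index. -/

section Decay

variable {E : Type*} [NormedAddCommGroup E] [InnerProductSpace ℂ E]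

theorem freq_pos {T : ℝ} (hT : 0 < T) : 0 < freq T := by
  have := Real.pi_pos
  unfold freq; positivity

/-- The diagonal coefficient is at least `|k|ω - |e|`, which exceeds `K α` because `ω T = 2π ≥ 1`,
while each hop costs at most `α`. -/
theorem mul_norm_le_sum_norm {M : ℕ} {T α e : ℝ} {Hm : ℤ → E →L[ℂ] E} (hT : 0 < T)
    (hα : ∀ m : ℤ, |m| ≤ (M : ℤ) → ‖Hm m‖ ≤ α) {φ : ℤ → E} {k : ℤ}
    (heq : ∑ m ∈ Finset.Icc (-(M : ℤ)) (M : ℤ), Hm m (φ (k - m)) =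
      ((e : ℂ) + (k : ℂ) * (freq T : ℂ)) • φ k)
    {K : ℝ} (hK : 0 ≤ K) (hk : |e| / freq T + K * (α * T) < |(k : ℝ)|) :
    K * ‖φ k‖ ≤ ∑ m ∈ Finset.Icc (-(M : ℤ)) (M : ℤ), ‖φ (k - m)‖ := by
  have hω := freq_pos hT
  have hα₀ : 0 ≤ α := (norm_nonneg _).trans (hα 0 (by simp))
  set S := ∑ m ∈ Finset.Icc (-(M : ℤ)) (M : ℤ), ‖φ (k - m)‖
  have hS : 0 ≤ S := Finset.sum_nonneg fun _ _ => norm_nonneg _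
  have hgap : K * α < |(k : ℝ)| * freq T - |e| := by
    have h1 := mul_lt_mul_of_pos_right hk hω
    rw [add_mul, div_mul_cancel₀ _ hω.ne'] at h1
    have h2 : K * (α * T) * freq T = 2 * Real.pi * (K * α) := by
      unfold freq; field_simp
    have h3 : 0 ≤ K * α := by positivity
    nlinarith [Real.pi_gt_three]
  have hlow : (|(k : ℝ)| * freq T - |e|) * ‖φ k‖ ≤ α * S := by
    calc (|(k : ℝ)| * freq T - |e|) * ‖φ k‖
        ≤ ‖(e : ℂ) + (k : ℂ) * (freq T : ℂ)‖ * ‖φ k‖ := by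
          gcongr
          have h : (e : ℂ) + (k : ℂ) * (freq T : ℂ) = ((e + k * freq T : ℝ) : ℂ) := by push_cast; rfl
          rw [h, Complex.norm_real, Real.norm_eq_abs]
          have h2 := abs_sub_abs_le_abs_sub (k * freq T) (-e)
          rw [abs_mul, abs_of_pos hω, abs_neg, sub_neg_eq_add, add_comm _ e] at h2
          exact h2
      _ = ‖∑ m ∈ Finset.Icc (-(M : ℤ)) (M : ℤ), Hm m (φ (k - m))‖ := by rw [heq, norm_smul]
      _ ≤ ∑ m ∈ Finset.Icc (-(M : ℤ)) (M : ℤ), α * ‖φ (k - m)‖ :=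
        norm_sum_le_of_le _ fun m hm =>
          ((Hm m).le_opNorm _).trans (by
            gcongr; exact hα m (abs_le.2 (Finset.mem_Icc.1 hm)))
      _ = α * S := (Finset.mul_sum _ _ _).symm
  have hgap₀ : 0 < |(k : ℝ)| * freq T - |e| := lt_of_le_of_lt (by positivity) hgap
  refine le_of_mul_le_mul_left ?_ hgap₀
  have := mul_le_mul_of_nonneg_left hlow hK
  nlinarith

end Decay

/-! ### Continuity, boundedness, symmetry and periodicity of `H(t)`. -/

section Hamiltonian

variable {E : Type*} [NormedAddCommGroup E] [InnerProductSpace ℂ E]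
  {M : ℕ} {T : ℝ} {Hm : ℤ → E →L[ℂ] E}

theorem continuous_hamiltonian (M : ℕ) (T : ℝ) (Hm : ℤ → E →L[ℂ] E) :
    Continuous (hamiltonian M T Hm) := by
  unfold hamiltonian
  fun_prop

theorem norm_exp_neg_I_mul_ofReal (x : ℝ) : ‖Complex.exp (-(Complex.I * (x : ℂ)))‖ = 1 := by
  rw [mul_comm, ← neg_mul, ← Complex.ofReal_neg, Complex.norm_exp_ofReal_mul_I]

theorem norm_hamiltonian_le {α : ℝ} (hα : ∀ m : ℤ, |m| ≤ (M : ℤ) → ‖Hm m‖ ≤ α) (t : ℝ) :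
    ‖hamiltonian M T Hm t‖ ≤ (2 * M + 1) * α := by
  rw [← card_Icc_neg_natCast, ← nsmul_eq_mul, ← Finset.sum_const]
  refine norm_sum_le_of_le _ fun m hm => ?_
  have h := norm_exp_neg_I_mul_ofReal (m * freq T * t)
  push_cast at h
  rw [norm_smul, h, one_mul]
  exact hα m (abs_le.2 (Finset.mem_Icc.1 hm))

theorem inner_hamiltonian_left [CompleteSpace E]
    (hadj : ∀ m : ℤ, |m| ≤ (M : ℤ) → ContinuousLinearMap.adjoint (Hm m) = Hm (-m)) (t : ℝ)
    (x y : E) :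
    inner ℂ (hamiltonian M T Hm t x) y = inner ℂ x (hamiltonian M T Hm t y) := by
  simp only [hamiltonian, sum_apply, smul_apply, sum_inner,
    inner_sum, inner_smul_left, inner_smul_right]
  -- Under `m ↦ -m` the adjoint relation exchanges the operators, and conjugation exchanges the
  -- phases.
  refine Finset.sum_bij' (fun m _ => -m) (fun m _ => -m) (fun m hm => ?_) (fun m hm => ?_)
    (fun m _ => neg_neg m) (fun m _ => neg_neg m) fun m hm => ?_
  · rw [Finset.mem_Icc] at hm ⊢; omega
  · rw [Finset.mem_Icc] at hm ⊢; omega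
  · rw [← hadj m (abs_le.2 (Finset.mem_Icc.1 hm)), ContinuousLinearMap.adjoint_inner_right,
      ← Complex.exp_conj]
    congr 2
    simp

theorem hamiltonian_add_period (hT : T ≠ 0) (t : ℝ) :
    hamiltonian M T Hm (t + T) = hamiltonian M T Hm t := by
  unfold hamiltonian
  refine Finset.sum_congr rfl fun m _ => ?_
  congr 1
  rw [Complex.exp_eq_exp_iff_exists_int]
  refine ⟨-m, ?_⟩
  have hT' : (T : ℂ) ≠ 0 := by exact_mod_cast hT
  simp only [freq]
  push_cast
  field_simp
  ring

end Hamiltonian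

/-! ### The trigonometric ansatz and its truncation error. -/

section FourierSum

variable {E : Type*} [NormedAddCommGroup E] [InnerProductSpace ℂ E]

/-- The trigonometric polynomial `∑_{l ∈ [L]} exp(-i l ω t) φ_l`. -/
noncomputable def fourierSum (ω : ℝ) (L : ℕ) (φ : ℤ → E) (t : ℝ) : E :=
  ∑ l ∈ indexSet L, Complex.exp (-(Complex.I * ((l : ℂ) * (ω : ℂ) * (t : ℂ)))) • φ l

theorem fourierSum_zero (ω : ℝ) (L : ℕ) (φ : ℤ → E) :
    fourierSum ω L φ 0 = ∑ l ∈ indexSet L, φ l := by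
  simp [fourierSum]

theorem fourierSum_period {T : ℝ} (hT : T ≠ 0) (L : ℕ) (φ : ℤ → E) :
    fourierSum (freq T) L φ T = ∑ l ∈ indexSet L, φ l := by
  unfold fourierSum
  refine Finset.sum_congr rfl fun l _ => ?_
  have hT' : (T : ℂ) ≠ 0 := by exact_mod_cast hT
  have h : Complex.exp (-(Complex.I * ((l : ℂ) * (freq T : ℂ) * (T : ℂ)))) = 1 := by
    rw [Complex.exp_eq_one_iff]
    refine ⟨-l, ?_⟩
    simp only [freq]
    push_cast
    field_simp
  rw [h, one_smul]

theorem integral_exp_int_mul_freq {T : ℝ} (hT : T ≠ 0) {n : ℤ} (hn : n ≠ 0) :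
    ∫ t in (0 : ℝ)..T, Complex.exp (Complex.I * ((n : ℂ) * (freq T : ℂ)) * (t : ℂ)) = 0 := by
  have hT' : (T : ℂ) ≠ 0 := by exact_mod_cast hT
  have hn' : (n : ℂ) ≠ 0 := by exact_mod_cast hn
  have hc : Complex.I * ((n : ℂ) * (freq T : ℂ)) ≠ 0 := by
    simp only [freq]
    push_cast
    simp [hn', hT', Real.pi_ne_zero]
  rw [integral_exp_mul_complex hc]
  have h : Complex.exp (Complex.I * ((n : ℂ) * (freq T : ℂ)) * (T : ℂ)) = 1 := by
    rw [Complex.exp_eq_one_iff]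
    refine ⟨n, ?_⟩
    simp only [freq]
    push_cast
    field_simp
  rw [h]; simp

/-- By orthogonality of the exponentials, `φ k` is the mean over a period of `e^{ikωt}` times the
sum. -/
theorem norm_le_of_norm_fourierSum_le [CompleteSpace E] {T : ℝ} (hT : 0 < T) {L : ℕ}
    {φ : ℤ → E} {Q : ℝ}
    (hQ : ∀ t ∈ Set.Ioc 0 T, ‖fourierSum (freq T) L φ t‖ ≤ Q) {k : ℤ} (hk : k ∈ indexSet L) :
    ‖φ k‖ ≤ Q := by
  have hint : ∫ t in (0 : ℝ)..T, Complex.exp (Complex.I * ((k : ℂ) * (freq T : ℂ) * (t : ℂ))) •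
      fourierSum (freq T) L φ t = T • φ k := by
    have hexp : ∀ t : ℝ, Complex.exp (Complex.I * ((k : ℂ) * (freq T : ℂ) * (t : ℂ))) •
        fourierSum (freq T) L φ t = ∑ l ∈ indexSet L,
          Complex.exp (Complex.I * (((k - l : ℤ) : ℂ) * (freq T : ℂ)) * (t : ℂ)) • φ l := by
      intro t
      rw [fourierSum, Finset.smul_sum]
      refine Finset.sum_congr rfl fun l _ => ?_
      rw [smul_smul, ← Complex.exp_add]
      congr 2
      push_cast; ring
    simp_rw [hexp]
    rw [intervalIntegral.integral_finsetSum fun l _ =>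
      Continuous.intervalIntegrable (by fun_prop) _ _]
    simp_rw [intervalIntegral.integral_smul_const]
    rw [Finset.sum_eq_single k]
    · simp
    · intro l _ hl
      rw [integral_exp_int_mul_freq hT.ne' (sub_ne_zero.2 hl.symm), zero_smul]
    · exact fun h => absurd hk h
  have hle := intervalIntegral.norm_integral_le_of_norm_le_const (a := 0) (b := T) (C := Q)
    (f := fun t : ℝ => Complex.exp (Complex.I * ((k : ℂ) * (freq T : ℂ) * (t : ℂ))) •
      fourierSum (freq T) L φ t) (fun t ht => by
        rw [Set.uIoc_of_le hT.le] at ht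
        have h := Complex.norm_exp_ofReal_mul_I (k * freq T * t)
        rw [mul_comm] at h
        push_cast at h
        rw [norm_smul, h, one_mul]
        exact hQ t ht)
  rw [hint, norm_smul, sub_zero, Real.norm_eq_abs, abs_of_pos hT, mul_comm] at hle
  exact le_of_mul_le_mul_right hle hT

/-- The part of `H(t) ∑_l exp(-i l ω t) φ_l` with Fourier indices outside `[L]`. -/
noncomputable def boundaryTerm (M : ℕ) (T : ℝ) (Hm : ℤ → E →L[ℂ] E) (L : ℕ) (φ : ℤ → E)
    (t : ℝ) : E :=
  ∑ m ∈ Finset.Icc (-(M : ℤ)) (M : ℤ), ∑ l ∈ indexSet L with l + m ∉ indexSet L,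
    Complex.exp (-(Complex.I * (((l + m : ℤ) : ℂ) * (freq T : ℂ) * (t : ℂ)))) • Hm m (φ l)

theorem hamiltonian_fourierSum {M : ℕ} {T e : ℝ} {Hm : ℤ → E →L[ℂ] E} {L : ℕ} {φ : ℤ → E}
    (hφ : ∀ l, l ∉ indexSet L → φ l = 0)
    (heq : ∀ k ∈ indexSet L, ∑ m ∈ Finset.Icc (-(M : ℤ)) (M : ℤ), Hm m (φ (k - m)) =
      ((e : ℂ) + (k : ℂ) * (freq T : ℂ)) • φ k) (t : ℝ) :
    hamiltonian M T Hm t (fourierSum (freq T) L φ t) =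
      ∑ k ∈ indexSet L, Complex.exp (-(Complex.I * ((k : ℂ) * (freq T : ℂ) * (t : ℂ)))) •
        (((e : ℂ) + (k : ℂ) * (freq T : ℂ)) • φ k) + boundaryTerm M T Hm L φ t := by
  have h1 : hamiltonian M T Hm t (fourierSum (freq T) L φ t) =
      ∑ m ∈ Finset.Icc (-(M : ℤ)) (M : ℤ), ∑ l ∈ indexSet L,
        Complex.exp (-(Complex.I * (((l + m : ℤ) : ℂ) * (freq T : ℂ) * (t : ℂ)))) •
          Hm m (φ l) := by
    simp only [hamiltonian, fourierSum, sum_apply,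
      smul_apply, map_sum, map_smul, Finset.smul_sum]
    rw [Finset.sum_comm]
    refine Finset.sum_congr rfl fun m _ => Finset.sum_congr rfl fun l _ => ?_
    rw [smul_smul, ← Complex.exp_add]
    congr 2
    push_cast; ring
  have h2 : ∑ k ∈ indexSet L, Complex.exp (-(Complex.I * ((k : ℂ) * (freq T : ℂ) * (t : ℂ)))) •
        (((e : ℂ) + (k : ℂ) * (freq T : ℂ)) • φ k) =
      ∑ m ∈ Finset.Icc (-(M : ℤ)) (M : ℤ), ∑ l ∈ indexSet L with l + m ∈ indexSet L,
        Complex.exp (-(Complex.I * (((l + m : ℤ) : ℂ) * (freq T : ℂ) * (t : ℂ)))) •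
          Hm m (φ l) := by
    have h3 : ∀ k ∈ indexSet L, Complex.exp (-(Complex.I * ((k : ℂ) * (freq T : ℂ) * (t : ℂ)))) •
        (((e : ℂ) + (k : ℂ) * (freq T : ℂ)) • φ k) = ∑ m ∈ Finset.Icc (-(M : ℤ)) (M : ℤ),
          Complex.exp (-(Complex.I * ((k : ℂ) * (freq T : ℂ) * (t : ℂ)))) • Hm m (φ (k - m)) :=
      fun k hk => by rw [← heq k hk, Finset.smul_sum]
    rw [Finset.sum_congr rfl h3, Finset.sum_comm]
    refine Finset.sum_congr rfl fun m _ => ?_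
    -- Indices `k` with `k - m` outside `[L]` drop out by the zero extension, which makes the shift
    -- `k = l + m` a bijection.
    rw [← Finset.sum_filter_of_ne (p := fun k => k - m ∈ indexSet L) (fun k _ hne => by
      by_contra hk
      exact hne (by rw [hφ _ hk, map_zero, smul_zero]))]
    refine Finset.sum_bij' (fun k _ => k - m) (fun l _ => l + m) (fun k hk => ?_) (fun l hl => ?_)
      (fun k _ => sub_add_cancel k m) (fun l _ => add_sub_cancel_right l m) fun k hk => ?_
    · rw [Finset.mem_filter] at hk ⊢
      rw [sub_add_cancel]; exact ⟨hk.2, hk.1⟩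
    · rw [Finset.mem_filter] at hl ⊢
      rw [add_sub_cancel_right]; exact ⟨hl.2, hl.1⟩
    · rw [sub_add_cancel]
  rw [h1, h2, boundaryTerm, ← Finset.sum_add_distrib]
  exact Finset.sum_congr rfl fun m _ => (Finset.sum_filter_add_sum_filter_not _ _ _).symm

/-- A hop by `m` can leave `[L]` only from the last `M` sites at either end: at most `2M` indices,
all with `|l| ≥ L - M`. -/
theorem norm_boundaryTerm_le {M : ℕ} {T α S : ℝ} {Hm : ℤ → E →L[ℂ] E} {L : ℕ} {φ : ℤ → E}
    (hα : ∀ m : ℤ, |m| ≤ (M : ℤ) → ‖Hm m‖ ≤ α)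
    (hS : ∀ l : ℤ, (L : ℝ) - M ≤ |(l : ℝ)| → ‖φ l‖ ≤ S) (t : ℝ) :
    ‖boundaryTerm M T Hm L φ t‖ ≤ (2 * M + 1) * (2 * M * (α * S)) := by
  have hα₀ : 0 ≤ α := (norm_nonneg _).trans (hα 0 (by simp))
  have hS₀ : 0 ≤ S := (norm_nonneg _).trans (hS L (by simp))
  rw [← card_Icc_neg_natCast, ← nsmul_eq_mul, ← Finset.sum_const]
  refine norm_sum_le_of_le _ fun m hm => ?_
  have hm' := Finset.mem_Icc.1 hm
  have hmem : ∀ l, l ∈ indexSet L → l + m ∉ indexSet L →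
      l ∈ Finset.Ioc ((L : ℤ) - M) L ∪ Finset.Ioc (-(L : ℤ)) (-L + M) := by
    intro l hl hlm
    simp only [indexSet, Finset.mem_Icc, Finset.mem_union, Finset.mem_Ioc] at hl hlm ⊢
    omega
  have hcard : (({l ∈ indexSet L | l + m ∉ indexSet L} : Finset ℤ).card : ℝ) ≤ 2 * M := by
    have h1 : ({l ∈ indexSet L | l + m ∉ indexSet L} : Finset ℤ).card ≤
        (Finset.Ioc ((L : ℤ) - M) L ∪ Finset.Ioc (-(L : ℤ)) (-L + M)).card :=
      Finset.card_le_card fun l hl => by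
        rw [Finset.mem_filter] at hl
        exact hmem l hl.1 hl.2
    have h2 := Finset.card_union_le (Finset.Ioc ((L : ℤ) - M) L) (Finset.Ioc (-(L : ℤ)) (-L + M))
    simp only [Int.card_Ioc] at h2
    have h3 : ({l ∈ indexSet L | l + m ∉ indexSet L} : Finset ℤ).card ≤ 2 * M := by omega
    exact_mod_cast h3
  refine (norm_sum_le_of_le (n := fun _ => α * S) _ fun l hl => ?_).trans ?_
  · rw [Finset.mem_filter] at hl
    have h := norm_exp_neg_I_mul_ofReal ((l + m : ℤ) * freq T * t)
    push_cast at h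
    push_cast
    rw [norm_smul, h, one_mul]
    refine ((Hm m).le_opNorm _).trans
      (mul_le_mul (hα m (abs_le.2 hm')) (hS l ?_) (norm_nonneg _) hα₀)
    have hl' : (L : ℤ) - M ≤ |l| := by
      have := hmem l hl.1 hl.2
      simp only [Finset.mem_union, Finset.mem_Ioc] at this
      rcases this with h | h
      · exact h.1.le.trans (le_abs_self l)
      · have := neg_le_abs l
        omega
    exact_mod_cast hl'
  · rw [Finset.sum_const, nsmul_eq_mul]
    gcongr

/-- Differentiation multiplies the `l`-th mode by `-i(e + lω)`, which by the eigenvalue equation is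
the action of `-iH(t)` except for the hops out of `[L]`. -/
theorem hasDerivAt_exp_smul_fourierSum {M : ℕ} {T e : ℝ} {Hm : ℤ → E →L[ℂ] E} {L : ℕ} {φ : ℤ → E}
    (hφ : ∀ l, l ∉ indexSet L → φ l = 0)
    (heq : ∀ k ∈ indexSet L, ∑ m ∈ Finset.Icc (-(M : ℤ)) (M : ℤ), Hm m (φ (k - m)) =
      ((e : ℂ) + (k : ℂ) * (freq T : ℂ)) • φ k) (t : ℝ) :
    HasDerivAt (fun s : ℝ => Complex.exp (-(Complex.I * ((e : ℂ) * (s : ℂ)))) •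
        fourierSum (freq T) L φ s)
      ((-Complex.I) • hamiltonian M T Hm t (Complex.exp (-(Complex.I * ((e : ℂ) * (t : ℂ)))) •
        fourierSum (freq T) L φ t) + Complex.I •
          Complex.exp (-(Complex.I * ((e : ℂ) * (t : ℂ)))) • boundaryTerm M T Hm L φ t) t := by
  have hfun : (fun s : ℝ => Complex.exp (-(Complex.I * ((e : ℂ) * (s : ℂ)))) •
      fourierSum (freq T) L φ s) = fun s : ℝ => ∑ l ∈ indexSet L,
        Complex.exp ((s : ℂ) * (-(Complex.I * ((e : ℂ) + (l : ℂ) * (freq T : ℂ))))) • φ l := by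
    ext1 s
    rw [fourierSum, Finset.smul_sum]
    refine Finset.sum_congr rfl fun l _ => ?_
    rw [smul_smul, ← Complex.exp_add]
    congr 2
    ring
  rw [hfun, map_smul, hamiltonian_fourierSum hφ heq]
  have hder : ∀ l ∈ indexSet L, HasDerivAt (fun s : ℝ =>
      Complex.exp ((s : ℂ) * (-(Complex.I * ((e : ℂ) + (l : ℂ) * (freq T : ℂ))))) • φ l)
      ((-Complex.I * Complex.exp (-(Complex.I * ((e : ℂ) * (t : ℂ))))) •
        Complex.exp (-(Complex.I * ((l : ℂ) * (freq T : ℂ) * (t : ℂ)))) •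
        (((e : ℂ) + (l : ℂ) * (freq T : ℂ)) • φ l)) t := by
    intro l _
    have h := (((hasDerivAt_id t).ofReal_comp.mul_const
      (-(Complex.I * ((e : ℂ) + (l : ℂ) * (freq T : ℂ))))).cexp).smul_const (φ l)
    refine h.congr_deriv ?_
    rw [smul_smul, smul_smul, mul_assoc (-Complex.I), ← Complex.exp_add]
    congr 1
    simp only [id, Complex.ofReal_one]
    have harg : -(Complex.I * ((e : ℂ) * (t : ℂ))) +
        -(Complex.I * ((l : ℂ) * (freq T : ℂ) * (t : ℂ))) =
        (t : ℂ) * -(Complex.I * ((e : ℂ) + (l : ℂ) * (freq T : ℂ))) := by ring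
    rw [harg]
    ring
  have h := HasDerivAt.fun_sum hder
  rw [← Finset.smul_sum] at h
  refine h.congr_deriv ?_
  simp only [smul_add, neg_smul, neg_mul, mul_smul]
  abel

end FourierSum

/-! ### Choice of the cutoff constant. -/

/-- Here `x` stands for `αT` and `y` for `|e|/ω`. With `u = L / (4(M+1))`, half of `L` absorbs the
decay threshold, leaving a factor `e^{2-2u}`. One `e^{-u}` is at most `ε`; the other absorbs the
prefactor through `u e^{-u} ≤ 1`. -/
theorem cutoff_estimate {M : ℕ} {x y ε L : ℝ} (hx : 0 ≤ x) (hy : 0 ≤ y) (hε : 0 < ε) (hε₁ : ε < 1)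
    (hL : 144 * (M + 1) ^ 2 * (2 * M + 1) * (x + y + Real.log (1 / ε)) ≤ L) :
    (2 * M + 1) * (2 * M * x) *
      Real.exp (1 - (L - M - (y + 3 * (2 * M + 1) * x)) / (M + 1)) ≤ ε / 2 := by
  have hM : (0 : ℝ) ≤ M := M.cast_nonneg
  set N : ℝ := (M : ℝ) + 1 with hN
  have hN₁ : 1 ≤ N := by linarith
  have hlog : 0 ≤ Real.log (1 / ε) := Real.log_nonneg (by rw [le_div_iff₀ hε]; linarith)
  set q : ℝ := 2 * M + 1
  have hq : 1 ≤ q := by simp only [q]; linarith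
  have hNq : N * q ≤ N ^ 2 * q := by
    have := mul_le_mul_of_nonneg_right (show N ≤ N ^ 2 by nlinarith) (show 0 ≤ q by linarith)
    linarith
  have hNN : N ≤ N * q := le_mul_of_one_le_right (by linarith) hq
  have hqq : q ≤ N * q := le_mul_of_one_le_left (by linarith) hN₁
  set P : ℝ := N ^ 2 * q
  have hLx : 144 * P * x ≤ L := by
    have h1 : 0 ≤ P * y := by positivity
    have h2 : 0 ≤ P * Real.log (1 / ε) := by positivity
    simp only [P] at *; nlinarith
  have hLk : 2 * (y + 3 * q * x) ≤ L := by
    have h2 : 0 ≤ P * Real.log (1 / ε) := by positivity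
    have h3 : 1 * y ≤ P * y := by gcongr; linarith
    have h4 : q * x ≤ P * x := by gcongr; linarith
    have h5 : 144 * (P * x + P * y + P * Real.log (1 / ε)) ≤ L := by
      simp only [P]; linarith
    nlinarith [mul_nonneg (show 0 ≤ q by linarith) hx]
  have hLε : 4 * N * Real.log (1 / ε) ≤ L := by
    have h1 : 0 ≤ P * x := by positivity
    have h2 : 0 ≤ P * y := by positivity
    have h3 : N * Real.log (1 / ε) ≤ P * Real.log (1 / ε) := by gcongr; linarith
    have h4 : 0 ≤ P * Real.log (1 / ε) := by positivity
    have h5 : 144 * (P * x + P * y + P * Real.log (1 / ε)) ≤ L := by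
      simp only [P]; linarith
    linarith
  have hN₀ : 0 < N := by linarith
  obtain ⟨u, hu⟩ : ∃ u, u = L / (4 * N) := ⟨_, rfl⟩
  have hLu : L = 4 * N * u := by rw [hu]; field_simp
  -- The constant is `144 = 4 · 36`: with `e² ≤ 9` the prefactor is at most `18 N q x`, which must
  -- not exceed `u / 2`.
  have hux : 36 * (N * q * x) ≤ u := by
    refine le_of_mul_le_mul_left ?_ (show 0 < 4 * N by linarith)
    rw [← hLu]
    simp only [P] at hLx
    linarith
  have hεu : Real.exp (-u) ≤ ε := by
    rw [← Real.le_log_iff_exp_le hε]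
    rw [one_div, Real.log_inv, hLu] at hLε
    have := le_of_mul_le_mul_left hLε (show 0 < 4 * N by linarith)
    linarith
  have hexp : Real.exp (1 - (L - M - (y + 3 * q * x)) / N) ≤ 9 * (Real.exp (-u) * Real.exp (-u)) := by
    have h1 : 1 - (L - M - (y + 3 * q * x)) / N ≤ 2 + (-u + -u) := by
      have : (2 * u - 1) ≤ (L - M - (y + 3 * q * x)) / N := by
        rw [le_div_iff₀ hN₀]
        nlinarith
      linarith
    have h2 : Real.exp 2 ≤ 9 := by
      have : Real.exp 2 = Real.exp 1 * Real.exp 1 := by rw [← Real.exp_add]; norm_num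
      rw [this]
      nlinarith [Real.exp_one_lt_d9, Real.exp_pos 1]
    calc _ ≤ Real.exp (2 + (-u + -u)) := Real.exp_le_exp.2 h1
      _ = Real.exp 2 * (Real.exp (-u) * Real.exp (-u)) := by rw [Real.exp_add, Real.exp_add]
      _ ≤ _ := by gcongr
  have hue : u * Real.exp (-u) ≤ 1 := by
    rw [Real.exp_neg, ← div_eq_mul_inv, div_le_one (Real.exp_pos u)]
    linarith [Real.add_one_le_exp u]
  have hMN : q * (2 * M * x) * 9 ≤ u / 2 := by
    have : q * x * M ≤ q * x * N := by gcongr; linarith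
    linarith
  calc _ ≤ q * (2 * M * x) * (9 * (Real.exp (-u) * Real.exp (-u))) := by gcongr
    _ = (q * (2 * M * x) * 9) * Real.exp (-u) * Real.exp (-u) := by ring
    _ ≤ (u / 2) * Real.exp (-u) * Real.exp (-u) := by gcongr
    _ = (u * Real.exp (-u)) * Real.exp (-u) / 2 := by ring
    _ ≤ 1 * ε / 2 := by gcongr
    _ = ε / 2 := by ring

/-! ### Assembly of the estimates over one period. -/

section Main

variable {E : Type*} [NormedAddCommGroup E] [InnerProductSpace ℂ E]

theorem norm_component_le {M : ℕ} {T α e : ℝ} {Hm : ℤ → E →L[ℂ] E} (hT : 0 < T)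
    (hα : ∀ m : ℤ, |m| ≤ (M : ℤ) → ‖Hm m‖ ≤ α) {L : ℕ} {Φ : TruncatedSambe E L}
    (hΦ : Module.End.HasEigenvector (truncatedHamiltonian M T Hm L) (e : ℂ) Φ) {A : ℝ}
    (hA₀ : 0 ≤ A) (hA : ∀ l, ‖component Φ l‖ ≤ A) (k : ℤ) :
    ‖component Φ k‖ ≤ A * Real.exp
      (1 - (|(k : ℝ)| - (|e| / freq T + 3 * (2 * M + 1) * (α * T))) / (M + 1)) := by
  refine le_exp_of_decay (a := fun l => ‖component Φ l‖) hA₀ hA (fun l hl => ?_) k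
  by_cases hmem : l ∈ indexSet L
  · exact mul_norm_le_sum_norm hT hα (component_eigenvector hΦ hmem) (by positivity) hl
  · simp only [component_of_notMem Φ hmem, norm_zero, mul_zero]
    exact Finset.sum_nonneg fun _ _ => norm_nonneg _

theorem norm_boundaryTerm_component_le {M : ℕ} {T α e ε : ℝ} {Hm : ℤ → E →L[ℂ] E} (hT : 0 < T)
    (hα : ∀ m : ℤ, |m| ≤ (M : ℤ) → ‖Hm m‖ ≤ α) (hε : 0 < ε) (hε₁ : ε < 1)
    {L : ℕ} {Φ : TruncatedSambe E L}
    (hΦ : Module.End.HasEigenvector (truncatedHamiltonian M T Hm L) (e : ℂ) Φ) {A : ℝ}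
    (hA₀ : 0 ≤ A) (hA : ∀ l, ‖component Φ l‖ ≤ A)
    (hL : 144 * (M + 1) ^ 2 * (2 * M + 1) * (α * T + |e| / freq T + Real.log (1 / ε)) ≤ (L : ℝ))
    (t : ℝ) :
    ‖boundaryTerm M T Hm L (component Φ) t‖ ≤ A * (ε / 2) / T := by
  have hα₀ : 0 ≤ α := (norm_nonneg _).trans (hα 0 (by simp))
  have hω := freq_pos hT
  have hcut := cutoff_estimate (M := M) (mul_nonneg hα₀ hT.le)
    (show 0 ≤ |e| / freq T by positivity) hε hε₁ hL
  set k₀ := |e| / freq T + 3 * (2 * M + 1) * (α * T)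
  have hb := norm_boundaryTerm_le (T := T) (L := L) (φ := component Φ) hα
    (S := A * Real.exp (1 - ((L : ℝ) - M - k₀) / (M + 1))) (fun l hl =>
      (norm_component_le hT hα hΦ hA₀ hA l).trans (by gcongr)) t
  refine hb.trans ?_
  rw [le_div_iff₀ hT]
  calc _ = A * ((2 * M + 1) * (2 * M * (α * T)) *
        Real.exp (1 - ((L : ℝ) - M - k₀) / (M + 1))) := by ring
    _ ≤ _ := by gcongr

theorem norm_evolution_period_sub_le [CompleteSpace E] {M : ℕ} {T α e ε : ℝ}
    {Hm : ℤ → E →L[ℂ] E} (hT : 0 < T)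
    (hadj : ∀ m : ℤ, |m| ≤ (M : ℤ) → ContinuousLinearMap.adjoint (Hm m) = Hm (-m))
    (hα : ∀ m : ℤ, |m| ≤ (M : ℤ) → ‖Hm m‖ ≤ α) (hε : 0 < ε) (hε₁ : ε < 1)
    {L : ℕ} {Φ : TruncatedSambe E L}
    (hΦ : Module.End.HasEigenvector (truncatedHamiltonian M T Hm L) (e : ℂ) Φ)
    (hL : 144 * (M + 1) ^ 2 * (2 * M + 1) * (α * T + |e| / freq T + Real.log (1 / ε)) ≤ (L : ℝ)) :
    0 < ‖∑ l : indexSet L, Φ l‖ ∧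
      ‖evolution (hamiltonian M T Hm) T 0 (∑ l : indexSet L, Φ l)
        - Complex.exp (-(Complex.I * ((e : ℂ) * (T : ℂ)))) • ∑ l : indexSet L, Φ l‖ ≤
      ε * ‖∑ l : indexSet L, Φ l‖ := by
  set H := hamiltonian M T Hm
  set v := ∑ l : indexSet L, Φ l with hv
  have hcont : Continuous H := continuous_hamiltonian M T Hm
  have hbd : ∀ t, ‖H t‖ ≤ (2 * M + 1) * α := norm_hamiltonian_le hα
  have hsym : ∀ t x y, inner ℂ (H t x) y = inner ℂ x (H t y) := inner_hamiltonian_left hadj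
  obtain ⟨j, hj⟩ : ∃ j, Φ j ≠ 0 := by
    by_contra! h
    exact hΦ.2 (PiLp.ext h)
  obtain ⟨k, hk, hmax⟩ := (indexSet L).exists_max_image (fun l => ‖component Φ l‖) ⟨j, j.2⟩
  set A := ‖component Φ k‖ with hAdef
  have hA₀ : 0 < A :=
    (norm_pos_iff.2 hj).trans_le (by rw [← component_coe Φ j]; exact hmax j j.2)
  have hA : ∀ l, ‖component Φ l‖ ≤ A := fun l => by
    by_cases hl : l ∈ indexSet L
    · exact hmax l hl
    · rw [component_of_notMem Φ hl, norm_zero]; exact hA₀.le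
  have hr := norm_boundaryTerm_component_le hT hα hε hε₁ hΦ hA₀.le hA hL
  set δ := A * (ε / 2) / T
  have hδT : δ * T = A * (ε / 2) := div_mul_cancel₀ _ hT.ne'
  have hδ₀ : 0 ≤ δ := by positivity
  set ψ : ℝ → E := fun s => Complex.exp (-(Complex.I * ((e : ℂ) * (s : ℂ)))) •
    fourierSum (freq T) L (component Φ) s with hψdef
  have hphase : ∀ s : ℝ, ‖Complex.exp (-(Complex.I * ((e : ℂ) * (s : ℂ))))‖ = 1 := fun s => by
    have h := norm_exp_neg_I_mul_ofReal (e * s)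
    push_cast at h
    exact h
  have hψ := hasDerivAt_exp_smul_fourierSum (Hm := Hm)
    (fun l hl => component_of_notMem Φ hl) (fun l hl => component_eigenvector hΦ hl)
  have hu := hasDerivAt_evolution_apply hcont hbd 0 v
  have hdist : ∀ t, ‖ψ t - evolution H t 0 v‖ ≤ δ * |t| := by
    refine norm_le_of_forced_schrodinger hcont hbd hsym (g := fun t => Complex.I •
      Complex.exp (-(Complex.I * ((e : ℂ) * (t : ℂ)))) • boundaryTerm M T Hm L (component Φ) t)
      ?_ (fun t => ?_) (fun t => ?_)
    · simp [hψdef, fourierSum_zero, sum_component, evolution_self, hv]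
    · refine ((hψ t).fun_sub (hu t)).congr_deriv ?_
      simp only [hψdef, map_sub, smul_sub, H]
      abel
    · rw [norm_smul, norm_smul, hphase, Complex.norm_I, one_mul, one_mul]
      exact hr t
  have hnorm : ∀ t, ‖evolution H t 0 v‖ = ‖v‖ := fun t => by
    rw [norm_eq_of_schrodinger hsym hu t 0, evolution_self]; rfl
  -- This excludes cancellation in `v`: throughout the period `‖ψ t‖` is within `δ T` of `‖v‖`, and
  -- it bounds the largest Fourier coefficient.
  have hAv : A ≤ ‖v‖ + δ * T := by
    refine norm_le_of_norm_fourierSum_le hT (fun t ht => ?_) hk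
    have h1 : ‖fourierSum (freq T) L (component Φ) t‖ = ‖ψ t‖ := by
      rw [hψdef, norm_smul, hphase, one_mul]
    have h2 := norm_le_norm_add_norm_sub (evolution H t 0 v) (ψ t)
    rw [norm_sub_rev, hnorm] at h2
    have h3 := hdist t
    rw [abs_of_pos ht.1] at h3
    have h4 : δ * t ≤ δ * T := by gcongr; exact ht.2
    linarith
  -- Since `ε < 1`, the error `A ε / 2` is below `A / 2` and can be absorbed on the left.
  have hAv' : A / 2 ≤ ‖v‖ := by
    rw [hδT] at hAv
    nlinarith
  refine ⟨by linarith, ?_⟩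
  -- At `t = T` every phase `e^{-ilωT}` is 1, so `ψ T = e^{-ieT} v`.
  have hT' := hdist T
  rw [abs_of_pos hT, hδT, norm_sub_rev] at hT'
  simp only [hψdef, fourierSum_period hT.ne', sum_component, ← hv] at hT'
  nlinarith

/-- By periodicity `s ↦ U(s+T;0)v` solves the same equation as `s ↦ U(s;0)v`, hence so does the
defect, whose norm is therefore conserved. -/
theorem norm_evolution_add_period_sub_eq [CompleteSpace E] {H : ℝ → E →L[ℂ] E} {B T : ℝ}
    (hH : Continuous H) (hB : ∀ t, ‖H t‖ ≤ B)
    (hsym : ∀ t x y, inner ℂ (H t x) y = inner ℂ x (H t y)) (hper : ∀ t, H (t + T) = H t)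
    (c : ℂ) (v : E) (t : ℝ) :
    ‖evolution H (t + T) t (evolution H t 0 v) - c • evolution H t 0 v‖ =
      ‖evolution H T 0 v - c • v‖ := by
  have hu := hasDerivAt_evolution_apply hH hB 0 v
  have hcomp : evolution H (t + T) t (evolution H t 0 v) = evolution H (t + T) 0 v :=
    eq_of_schrodinger hsym (hasDerivAt_evolution_apply hH hB t (evolution H t 0 v)) hu
      (t₀ := t) (by rw [evolution_self]; rfl) (t + T)
  have hshift : ∀ s, HasDerivAt (fun s => evolution H (s + T) 0 v - c • evolution H s 0 v)
      ((-Complex.I) • H s (evolution H (s + T) 0 v - c • evolution H s 0 v)) s := fun s => by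
    have h1 := (hu (s + T)).comp_add_const s T
    rw [hper] at h1
    refine (h1.fun_sub ((hu s).fun_const_smul c)).congr_deriv ?_
    rw [map_sub, smul_sub, map_smul, smul_comm c]
  have h := norm_eq_of_schrodinger hsym hshift t 0
  rw [zero_add, evolution_self] at h
  rw [hcomp]
  exact h

end Main

end Floquet

theorem propositionB1 (M : ℕ) :
    ∃ C : ℝ, 0 < C ∧
      ∀ (d : ℕ) (T α : ℝ)
        (Hm : ℤ → EuclideanSpace ℂ (Fin d) →L[ℂ] EuclideanSpace ℂ (Fin d)),
        0 < T →
        (∀ m : ℤ, |m| ≤ (M : ℤ) → ContinuousLinearMap.adjoint (Hm m) = Hm (-m)) →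
        (∀ m : ℤ, |m| ≤ (M : ℤ) → ‖Hm m‖ ≤ α) →
        ∀ ε : ℝ, 0 < ε → ε < 1 →
        ∀ (L : ℕ) (e : ℝ) (Φ : Floquet.TruncatedSambe (EuclideanSpace ℂ (Fin d)) L),
          Module.End.HasEigenvector (Floquet.truncatedHamiltonian M T Hm L) (e : ℂ) Φ →
          C * (α * T + |e| / Floquet.freq T + Real.log (1 / ε)) ≤ (L : ℝ) →
          ∀ t : ℝ,
            Floquet.approxFloquetState (Floquet.hamiltonian M T Hm) e Φ t ≠ 0 ∧
            ‖Floquet.evolution (Floquet.hamiltonian M T Hm) (t + T) t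
                  (Floquet.approxFloquetState (Floquet.hamiltonian M T Hm) e Φ t)
                - Complex.exp (-(Complex.I * ((e : ℂ) * (T : ℂ)))) •
                    Floquet.approxFloquetState (Floquet.hamiltonian M T Hm) e Φ t‖
              / ‖Floquet.approxFloquetState (Floquet.hamiltonian M T Hm) e Φ t‖ ≤ ε := by
  refine ⟨144 * (M + 1) ^ 2 * (2 * M + 1), by positivity, ?_⟩
  intro d T α Hm hT hadj hα ε hε hε₁ L e Φ hΦ hL t
  obtain ⟨hv, hle⟩ := Floquet.norm_evolution_period_sub_le hT hadj hα hε hε₁ hΦ hL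
  have hcont := Floquet.continuous_hamiltonian M T Hm
  have hbd := Floquet.norm_hamiltonian_le (T := T) hα
  have hsym := Floquet.inner_hamiltonian_left (T := T) hadj
  set H := Floquet.hamiltonian M T Hm
  set v := ∑ l : Floquet.indexSet L, Φ l
  have hphase : ‖Complex.exp (Complex.I * ((e : ℂ) * (t : ℂ)))‖ = 1 := by
    have h := Complex.norm_exp_ofReal_mul_I (e * t)
    rw [mul_comm] at h
    push_cast at h
    exact h
  have hnorm : ‖Floquet.approxFloquetState H e Φ t‖ = ‖v‖ := by
    rw [Floquet.approxFloquetState, norm_smul, hphase, one_mul,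
      Floquet.norm_eq_of_schrodinger hsym (Floquet.hasDerivAt_evolution_apply hcont hbd 0 v) t 0,
      Floquet.evolution_self]
    rfl
  refine ⟨norm_pos_iff.1 (hnorm ▸ hv), ?_⟩
  rw [hnorm, div_le_iff₀ hv, Floquet.approxFloquetState, map_smul, smul_comm, ← smul_sub,
    norm_smul, hphase, one_mul, Floquet.norm_evolution_add_period_sub_eq hcont hbd hsym
      (Floquet.hamiltonian_add_period hT.ne')]
  exact hle
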